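/- Let $\varphi := \frac{1+\sqrt5}{2}$ be the golden ratio, and let $\mathcal R_\varphi := (\mathbb R, <, +, \mathbb Z, \mathbb Z\varphi)$ be the first-order structure on the real numbers whose primitives are the order, the addition, and unary predicates for the sets $\mathbb Z$ and $\mathbb Z\varphi=\{k\varphi : k\in\mathbb Z\}$. Then the function $\lambda_\varphi:\mathbb R\to\mathbb R$, $x\mapsto \varphi x$, is definable without parameters in $\mathcal R_\varphi$; that is, its graph $\{(x,y)\in\mathbb R^2 : y=\varphi x\}$ is defined by a first-order formula in the language of $\mathcal R_\varphi$ without parameters. -/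

import Mathlib

/-- Function symbols of the language `{<, +, P, Q}`: one binary symbol for addition. -/
inductive RFunctions : ℕ → Type
  | add : RFunctions 2

/-- Relation symbols of the language `{<, +, P, Q}`: a binary symbol for the order and two unary
predicate symbols, to be interpreted as `ℤ` and as `ℤ a`. -/
inductive RRelations : ℕ → Type
  | lt : RRelations 2
  | isInt : RRelations 1
  | isIntMul : RRelations 1

/-- The first-order language `{<, +, P, Q}` of the structures `(ℝ, <, +, ℤ, ℤ a)`. -/
def RLang : FirstOrder.Language.{0, 0} where
  Functions := RFunctions
  Relations := RRelations

/-- The structure `(ℝ, <, +, ℤ, ℤ a)`, for a real number `a`. -/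
@[reducible]
def RStructure (a : ℝ) : RLang.Structure ℝ where
  funMap
    | RFunctions.add, v => v 0 + v 1
  RelMap
    | RRelations.lt, v => v 0 < v 1
    | RRelations.isInt, v => ∃ k : ℤ, v 0 = k
    | RRelations.isIntMul, v => ∃ k : ℤ, v 0 = k * a

/-- A function `f : ℝ → ℝ` is definable (without parameters) in `(ℝ, <, +, ℤ, ℤ a)` if its graph
`{(x, y) | y = f x}` is a definable subset of `ℝ × ℝ`. -/
def DefinableInR (a : ℝ) (f : ℝ → ℝ) : Prop :=
  letI : RLang.Structure ℝ := RStructure a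
  (∅ : Set ℝ).Definable₂ RLang {p : ℝ × ℝ | p.2 = f p.1}

/-!
If `n` is a sum of pairwise non-consecutive Fibonacci numbers `F_i`, then, modulo `ℤ`, `n φ` is
minus the sum of the small numbers `ψ ^ i`, where `ψ = -1 / φ`. Hence `F_k` occurs in the
Zeckendorf representation of `n` if and only if for some integer `r` in `[F_k, F_{k+1})` the number
`(n - r) φ` lies, modulo `ℤ`, between `ψ ^ (k + 1)` and `ψ ^ (k + 2)`. Multiplying by `φ` turns
this into a condition on `n - r` modulo `ℤ φ`, so the digits of `n` can be read off from
`n φ ∈ ℤ φ` modulo `ℤ` and from `n ∈ ℤ` modulo `ℤ φ`. The pairs `F_k φ`, `F_{k+1} φ` and the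
nearest integers `F_{k+1}`, `F_{k+2}` are definable because they are the consecutive best
approximations of `ℤ φ` by `ℤ`. This defines `n ↦ n φ` on `ℕ` as the relation of having the same
digits; it extends to `ℤ` by sign, to `ℤ + ℤ φ` by `φ (m + n φ) = m φ + n φ + n`, and to `ℝ` by
density.
-/

open Real Set FirstOrder
open Nat (fib zeckendorf)
open AddSubgroup (zmultiples)
open scoped goldenRatio

theorem fib_mul_goldenRatio_sub_fib_succ (k : ℕ) : (fib k : ℝ) * φ - fib (k + 1) = -ψ ^ k := by
  rw [← fib_succ_sub_goldenRatio_mul_fib]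
  ring

theorem exists_fib_combination (k : ℕ) (m t : ℤ) :
    ∃ a b : ℤ, m = a * fib (k + 1) + b * fib k ∧ t = a * fib (k + 2) + b * fib (k + 1) := by
  induction k with
  | zero => exact ⟨m, t - m, by simp, by simp⟩
  | succ k ih =>
    obtain ⟨a, b, rfl, rfl⟩ := ih
    refine ⟨b, a - b, ?_, ?_⟩
    · rw [Nat.fib_add_two]; push_cast; ring
    · rw [Nat.fib_add_two (n := k + 1), Nat.fib_add_two (n := k)]; push_cast; ring

theorem eq_one_and_eq_zero_of_abs_mul_goldenConj_add_lt {a b p q : ℤ} (hp : 0 < p) (hq : 0 ≤ q)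
    (hqp : q ≤ p) (hpos : 0 < a * p + b * q) (hlt : a * p + b * q < p + q)
    (hab : |a * ψ + b| < 1) : a = 1 ∧ b = 0 := by
  obtain ⟨hlo, hhi⟩ := abs_lt.1 hab
  have hψ := goldenConj_neg
  rcases lt_trichotomy b 0 with hb | rfl | hb
  · have hb' : (b : ℝ) ≤ -1 := by exact_mod_cast Int.le_sub_one_of_lt hb
    have ha : a < 0 := by
      have : (a : ℝ) < 0 := by nlinarith
      exact_mod_cast this
    nlinarith
  · have ha₀ : 0 < a := by nlinarith
    have ha₂ : a < 2 := by nlinarith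
    exact ⟨by omega, rfl⟩
  · have hb' : (1 : ℝ) ≤ b := by exact_mod_cast hb
    have ha : 0 < a := by
      have : (0 : ℝ) < a := by nlinarith
      exact_mod_cast this
    nlinarith

theorem eq_fib_succ_of_abs_mul_goldenRatio_sub_lt {k : ℕ} {m t : ℤ} (hm : 0 < m)
    (hmk : m < fib (k + 2)) (h : |m * φ - t| < |ψ| ^ k) :
    m = fib (k + 1) ∧ t = fib (k + 2) := by
  obtain ⟨a, b, rfl, rfl⟩ := exists_fib_combination k m t
  have hab : |a * ψ + b| < 1 := by
    have hfactor : ((a * fib (k + 1) + b * fib k : ℤ) : ℝ) * φ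
        - (a * fib (k + 2) + b * fib (k + 1) : ℤ) = -ψ ^ k * (a * ψ + b) := by
      push_cast
      linear_combination a * fib_mul_goldenRatio_sub_fib_succ (k + 1)
        + b * fib_mul_goldenRatio_sub_fib_succ k
    rw [hfactor, abs_mul, abs_neg, abs_pow] at h
    exact (mul_lt_iff_lt_one_right (pow_pos (abs_pos.2 goldenConj_ne_zero) k)).1 h
  rw [Nat.fib_add_two, Nat.cast_add, add_comm (fib k : ℤ)] at hmk
  obtain ⟨rfl, rfl⟩ := eq_one_and_eq_zero_of_abs_mul_goldenConj_add_lt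
    (by exact_mod_cast Nat.fib_pos.2 k.succ_pos) (Int.natCast_nonneg _)
    (by exact_mod_cast Nat.fib_le_fib_succ) hm hmk hab
  simp

/-- The open interval with endpoints `ψ ^ k` and `ψ ^ (k + 1)`, which have opposite signs. -/
def conjInterval (k : ℕ) : Set ℝ := uIoo (ψ ^ k) (ψ ^ (k + 1))

theorem mul_mem_uIoo_mul_iff {K : Type*} [Field K] [LinearOrder K] [IsStrictOrderedRing K]
    {a b c x : K} (hc : c ≠ 0) :
    c * x ∈ uIoo (c * a) (c * b) ↔ x ∈ uIoo a b := by
  rcases hc.lt_or_gt with hc | hc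
  · simp only [uIoo, mem_Ioo, inf_lt_iff, lt_sup_iff, mul_lt_mul_left_of_neg hc]; tauto
  · simp only [uIoo, mem_Ioo, inf_lt_iff, lt_sup_iff, mul_lt_mul_iff_right₀ hc]

theorem mem_conjInterval_iff {k : ℕ} {x : ℝ} :
    x ∈ conjInterval k ↔ ∃ z ∈ Ioo ψ 1, x = ψ ^ k * z := by
  have hψ : ψ ^ k ≠ 0 := pow_ne_zero k goldenConj_ne_zero
  have hscale (z : ℝ) : ψ ^ k * z ∈ conjInterval k ↔ z ∈ Ioo ψ 1 := by
    rw [← uIoo_of_ge (goldenConj_neg.le.trans zero_le_one), ← mul_mem_uIoo_mul_iff hψ, mul_one,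
      ← pow_succ, conjInterval]
  refine ⟨fun hx => ⟨x / ψ ^ k, ?_, (mul_div_cancel₀ x hψ).symm⟩, ?_⟩
  · rwa [← hscale, mul_div_cancel₀ x hψ]
  · rintro ⟨z, hz, rfl⟩
    exact (hscale z).2 hz

theorem conjInterval_antitone : Antitone conjInterval := by
  refine antitone_nat_of_succ_le fun k x hx => ?_
  obtain ⟨z, ⟨hlo, hhi⟩, rfl⟩ := mem_conjInterval_iff.1 hx
  refine mem_conjInterval_iff.2 ⟨ψ * z, ⟨?_, ?_⟩, by ring⟩ <;>
    nlinarith [goldenConj_neg, goldenConj_sq]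

theorem neg_sum_goldenConj_pow_mem_conjInterval {l : List ℕ}
    (hl : l.Pairwise fun a b => b + 2 ≤ a) {k : ℕ} (hk : ∀ i ∈ l, k < i) :
    -(l.map (ψ ^ ·)).sum ∈ conjInterval k := by
  induction l using List.reverseRecOn generalizing k with
  | nil => exact mem_conjInterval_iff.2 ⟨0, ⟨goldenConj_neg, one_pos⟩, by simp⟩
  | append_singleton l b ih =>
    rw [List.pairwise_append] at hl
    obtain ⟨j, rfl⟩ : ∃ j, b = j + 1 :=
      Nat.exists_eq_add_one.2 (Nat.zero_lt_of_lt (hk b (by simp)))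
    have hrest := ih hl.1 (k := j + 2) fun i hi => hl.2.2 i hi _ (List.mem_singleton_self _)
    obtain ⟨z, ⟨hlo, hhi⟩, hz⟩ := mem_conjInterval_iff.1 hrest
    refine conjInterval_antitone (Nat.lt_succ_iff.1 (hk (j + 1) (by simp)))
      (mem_conjInterval_iff.2 ⟨ψ ^ 2 * z - ψ, ⟨?_, ?_⟩, ?_⟩)
    · nlinarith [goldenConj_neg, goldenConj_sq]
    · nlinarith [sq_pos_of_neg goldenConj_neg, goldenConj_sq]
    · simp only [List.map_append, List.map_singleton, List.sum_append, List.sum_singleton]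
      linear_combination hz

local instance : IsTrans ℕ fun a b => b + 2 ≤ a := ⟨fun _ _ _ _ _ => by omega⟩

theorem isZeckendorfRep_filter {l : List ℕ} (hl : l.IsZeckendorfRep) (p : ℕ → Bool) :
    (l.filter p).IsZeckendorfRep :=
  List.IsChain.sublist hl (List.filter_sublist.append_right _)

theorem pairwise_zeckendorf (n : ℕ) : (zeckendorf n ++ [0]).Pairwise fun a b => b + 2 ≤ a :=
  List.isChain_iff_pairwise.1 (Nat.isZeckendorfRep_zeckendorf n)

theorem two_le_of_mem_zeckendorf {n k : ℕ} (hk : k ∈ zeckendorf n) : 2 ≤ k :=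
  (List.pairwise_append.1 (pairwise_zeckendorf n)).2.2 k hk 0 (List.mem_singleton_self 0)

theorem zeckendorf_gap {n i j : ℕ} (hi : i ∈ zeckendorf n) (hj : j ∈ zeckendorf n) :
    i = j ∨ i + 2 ≤ j ∨ j + 2 ≤ i := by
  let far (i j : ℕ) : Prop := i = j ∨ i + 2 ≤ j ∨ j + 2 ≤ i
  have : Std.Symm far := ⟨fun i j h => by grind⟩
  have hfar : (zeckendorf n).Pairwise far :=
    (List.pairwise_append.1 (pairwise_zeckendorf n)).1.imp fun h => .inr (.inr h)
  exact hfar.forall_of_forall (fun _ _ => .inl rfl) hi hj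

/-- The part of `n` formed by the terms of its Zeckendorf representation of index at most `k`. -/
def zeckendorfTrunc (n k : ℕ) : ℕ := (((zeckendorf n).filter (· ≤ k)).map fib).sum

theorem zeckendorfTrunc_lt {n k j : ℕ} (hj : 0 < j) (h : ∀ i ∈ zeckendorf n, i ≤ k → i < j) :
    zeckendorfTrunc n k < fib j := by
  refine (isZeckendorfRep_filter (Nat.isZeckendorfRep_zeckendorf n) _).sum_fib_lt fun i hi => ?_
  have hi' := List.mem_of_mem_head? hi
  simp only [List.mem_append, List.mem_filter, decide_eq_true_eq, List.mem_singleton] at hi'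
  rcases hi' with ⟨hin, hik⟩ | rfl
  exacts [h i hin hik, hj]

theorem exists_sub_zeckendorfTrunc_mul_mem_conjInterval {n k j : ℕ}
    (h : ∀ i ∈ zeckendorf n, k < i → j < i) :
    ∃ t : ℤ, ((n : ℝ) - zeckendorfTrunc n k) * φ - t ∈ conjInterval j := by
  let high := (zeckendorf n).filter fun i => ¬i ≤ k
  have hsplit : zeckendorfTrunc n k + (high.map fib).sum = n := by
    rw [zeckendorfTrunc, List.sum_map_filter_add_sum_map_filter_not, Nat.sum_zeckendorf_fib]
  have hsum (l : List ℕ) : ((l.map fib).sum : ℝ) * φ - (l.map fun i => fib (i + 1)).sum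
      = -(l.map (ψ ^ ·)).sum := by
    induction l with
    | nil => simp
    | cons i l ih =>
      simp only [List.map_cons, List.sum_cons, Nat.cast_add]
      linear_combination ih + fib_mul_goldenRatio_sub_fib_succ i
  refine ⟨(high.map fun i => fib (i + 1)).sum, ?_⟩
  rw [show (n : ℝ) - zeckendorfTrunc n k = (high.map fib).sum by
    rw [sub_eq_iff_eq_add']; exact_mod_cast hsplit.symm, Int.cast_natCast, hsum]
  refine neg_sum_goldenConj_pow_mem_conjInterval
    ((List.pairwise_append.1 (pairwise_zeckendorf n)).1.sublist List.filter_sublist) fun i hi => ?_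
  simp only [List.mem_filter, decide_eq_true_eq, not_le] at hi
  exact h i hi.1 hi.2

/-- The arithmetic form of `F_k` being a term of the Zeckendorf representation of `n`; `r` stands
for the sum of the terms of index at most `k`. -/
def HasFibDigit (n k : ℕ) : Prop :=
  ∃ r t : ℤ, fib k ≤ r ∧ r < fib (k + 1) ∧ ((n : ℝ) - r) * φ - t ∈ conjInterval (k + 1)

theorem exists_sub_eq_goldenConj_pow_mul_of_mem_conjInterval {k : ℕ} {x y : ℝ}
    (hx : x ∈ conjInterval (k + 1)) (hy : y ∈ conjInterval (k + 2)) :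
    ∃ z ∈ Ioo (-1) (-ψ), x - y = ψ ^ k * z := by
  obtain ⟨p, ⟨hplo, hphi⟩, rfl⟩ := mem_conjInterval_iff.1 hx
  obtain ⟨q, ⟨hqlo, hqhi⟩, rfl⟩ := mem_conjInterval_iff.1 hy
  refine ⟨ψ * p - ψ ^ 2 * q, ⟨?_, ?_⟩, by ring⟩ <;>
    nlinarith [goldenConj_neg, goldenConj_sq, sq_pos_of_neg goldenConj_neg]

theorem mem_zeckendorf_of_hasFibDigit {n k : ℕ} (hk : 0 < k) (h : HasFibDigit n k) :
    k ∈ zeckendorf n := by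
  obtain ⟨r, t, hkr, hrk, hr⟩ := h
  by_contra hmem
  obtain ⟨k, rfl⟩ : ∃ j, k = j + 1 := Nat.exists_eq_add_one.2 hk
  obtain ⟨s, hs⟩ := exists_sub_zeckendorfTrunc_mul_mem_conjInterval (n := n) (k := k + 1)
    (fun _ _ => id)
  have hlt : zeckendorfTrunc n (k + 1) < fib (k + 1) := zeckendorfTrunc_lt k.succ_pos
    fun i hi hik => hik.lt_of_ne fun h => hmem (h ▸ hi)
  obtain ⟨z, ⟨hzlo, hzhi⟩, hz⟩ := exists_sub_eq_goldenConj_pow_mul_of_mem_conjInterval hs hr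
  have hdiff : ((r - zeckendorfTrunc n (k + 1) : ℤ) : ℝ) * φ - (s - t : ℤ) = ψ ^ k * z := by
    rw [← hz]
    push_cast
    ring
  have hsmall : |((r - zeckendorfTrunc n (k + 1) : ℤ) : ℝ) * φ - (s - t : ℤ)| < |ψ| ^ k := by
    rw [hdiff, abs_mul, abs_pow]
    exact mul_lt_of_lt_one_right (pow_pos (abs_pos.2 goldenConj_ne_zero) k)
      (abs_lt.2 ⟨hzlo, hzhi.trans (by linarith [neg_one_lt_goldenConj])⟩)
  obtain ⟨hfib, hfib'⟩ := eq_fib_succ_of_abs_mul_goldenRatio_sub_lt (by omega)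
    ((Int.sub_le_self r (Int.natCast_nonneg _)).trans_lt hrk) hsmall
  rw [hfib, hfib', Int.cast_natCast, Int.cast_natCast, fib_mul_goldenRatio_sub_fib_succ, pow_succ,
    ← mul_neg, mul_right_inj' (pow_ne_zero k goldenConj_ne_zero)] at hdiff
  exact hzhi.ne' hdiff

theorem hasFibDigit_of_mem_zeckendorf {n k : ℕ} (hmem : k ∈ zeckendorf n) : HasFibDigit n k := by
  obtain ⟨t, ht⟩ := exists_sub_zeckendorfTrunc_mul_mem_conjInterval (n := n) (k := k)
    (j := k + 1) fun i hi hki => by have := zeckendorf_gap hi hmem; omega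
  refine ⟨zeckendorfTrunc n k, t, ?_, ?_, ht⟩
  · exact_mod_cast List.le_sum_of_mem (List.mem_map_of_mem (by simpa using hmem))
  · exact_mod_cast zeckendorfTrunc_lt k.succ_pos fun i _ hi => Nat.lt_succ_of_le hi

theorem hasFibDigit_iff_mem_zeckendorf {n k : ℕ} (hk : 0 < k) :
    HasFibDigit n k ↔ k ∈ zeckendorf n :=
  ⟨mem_zeckendorf_of_hasFibDigit hk, hasFibDigit_of_mem_zeckendorf⟩

theorem zeckendorf_injective : Function.Injective zeckendorf :=
  Function.LeftInverse.injective (g := fun l : List ℕ => (l.map fib).sum) Nat.sum_zeckendorf_fib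

theorem sortedGT_zeckendorf (n : ℕ) : (zeckendorf n).SortedGT :=
  ((List.pairwise_append.1 (pairwise_zeckendorf n)).1.imp
    fun h => (Nat.lt_add_of_pos_right two_pos).trans_le h).sortedGT

theorem eq_of_hasFibDigit_iff {n m : ℕ} (h : ∀ k, 2 ≤ k → (HasFibDigit n k ↔ HasFibDigit m k)) :
    n = m := by
  refine zeckendorf_injective
    ((sortedGT_zeckendorf n).eq_of_mem_iff (sortedGT_zeckendorf m) fun k => ?_)
  by_cases hk : 2 ≤ k
  · have hk₀ : 0 < k := two_pos.trans_le hk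
    rw [← hasFibDigit_iff_mem_zeckendorf hk₀, h k hk, hasFibDigit_iff_mem_zeckendorf hk₀]
  · exact iff_of_false (mt two_le_of_mem_zeckendorf hk) (mt two_le_of_mem_zeckendorf hk)

/-- `v` and `w` are consecutive best approximations among the positive elements of `A` by elements
`c` and `d` of `B`: no positive element of `A` before `w` is nearer to `B` than `v` is to `c`, but
`w` is nearer to `d`. -/
def IsConsecutiveBestApprox (A B : AddSubgroup ℝ) (v c w d : ℝ) : Prop :=
  v ∈ A ∧ c ∈ B ∧ w ∈ A ∧ d ∈ B ∧ 0 < v ∧ v < w ∧ |w - d| < |v - c| ∧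
    ∀ u ∈ A, ∀ t ∈ B, 0 < u → u < w → |v - c| ≤ |u - t|

theorem mem_zmultiples_iff_exists_mul {a x : ℝ} : x ∈ zmultiples a ↔ ∃ k : ℤ, x = k * a := by
  simp only [AddSubgroup.mem_zmultiples_iff, zsmul_eq_mul, eq_comm]

theorem abs_goldenConj_pow_lt {j k : ℕ} (h : j < k) : |ψ| ^ k < |ψ| ^ j :=
  pow_lt_pow_right_of_lt_one₀ (abs_pos.2 goldenConj_ne_zero)
    (abs_lt.2 ⟨neg_one_lt_goldenConj, goldenConj_neg.trans one_pos⟩) h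

theorem abs_fib_mul_goldenRatio_sub_fib_succ (k : ℕ) :
    |(fib k : ℝ) * φ - fib (k + 1)| = |ψ| ^ k := by
  rw [fib_mul_goldenRatio_sub_fib_succ, abs_neg, abs_pow]

theorem isConsecutiveBestApprox_fib {k : ℕ} (hk : 2 ≤ k) :
    IsConsecutiveBestApprox (zmultiples φ) (zmultiples 1)
      (fib k * φ) (fib (k + 1)) (fib (k + 1) * φ) (fib (k + 2)) := by
  obtain ⟨k, rfl⟩ : ∃ j, k = j + 1 := Nat.exists_eq_add_one.2 (two_pos.trans_le hk)
  simp only [IsConsecutiveBestApprox, mem_zmultiples_iff_exists_mul, mul_one]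
  refine ⟨⟨fib (k + 1), by simp⟩, ⟨fib (k + 2), by simp⟩, ⟨fib (k + 2), by simp⟩,
    ⟨fib (k + 3), by simp⟩, mul_pos ?_ goldenRatio_pos,
    mul_lt_mul_of_pos_right ?_ goldenRatio_pos, ?_, ?_⟩
  · exact_mod_cast Nat.fib_pos.2 k.succ_pos
  · exact_mod_cast Nat.fib_lt_fib_succ hk
  · rw [abs_fib_mul_goldenRatio_sub_fib_succ, abs_fib_mul_goldenRatio_sub_fib_succ]
    exact abs_goldenConj_pow_lt (Nat.lt_succ_self _)
  · rintro _ ⟨m, rfl⟩ _ ⟨t, rfl⟩ hm hmw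
    by_contra! hlt
    have hlt' := hlt.trans_eq (abs_fib_mul_goldenRatio_sub_fib_succ (k + 1))
    obtain ⟨rfl, rfl⟩ := eq_fib_succ_of_abs_mul_goldenRatio_sub_lt
      (by exact_mod_cast pos_of_mul_pos_left hm goldenRatio_pos.le)
      (by exact_mod_cast lt_of_mul_lt_mul_right hmw goldenRatio_pos.le)
      (hlt'.trans (abs_goldenConj_pow_lt k.lt_succ_self))
    simp at hlt

theorem exists_fib_succ_le_lt_fib_add_two {n : ℤ} (hn : 2 ≤ n) :
    ∃ k, 2 ≤ k ∧ fib (k + 1) ≤ n ∧ n < fib (k + 2) := by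
  lift n to ℕ using by omega
  have hgreatest : 3 ≤ Nat.greatestFib n := Nat.le_greatestFib.2 (by exact_mod_cast hn)
  obtain ⟨k, hk⟩ := Nat.exists_eq_add_of_le' hgreatest
  have hle := Nat.fib_greatestFib_le n
  have hlt := Nat.lt_fib_greatestFib_add_one n
  rw [hk] at hle hlt
  exact ⟨k + 2, by omega, by exact_mod_cast hle, by exact_mod_cast hlt⟩

theorem exists_fib_of_isConsecutiveBestApprox {v c w d : ℝ}
    (h : IsConsecutiveBestApprox (zmultiples φ) (zmultiples 1) v c w d) :
    ∃ k, 2 ≤ k ∧ v = fib k * φ ∧ c = fib (k + 1) ∧ w = fib (k + 1) * φ ∧ d = fib (k + 2) := by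
  simp only [IsConsecutiveBestApprox, mem_zmultiples_iff_exists_mul, mul_one] at h
  obtain ⟨⟨n, rfl⟩, ⟨a, rfl⟩, ⟨m, rfl⟩, ⟨b, rfl⟩, hn, hnm, hlt, hbest⟩ := h
  have hφ := goldenRatio_pos
  replace hn : 0 < n := by exact_mod_cast pos_of_mul_pos_left hn hφ.le
  replace hnm : n < m := by exact_mod_cast lt_of_mul_lt_mul_right hnm hφ.le
  have hbest_fib {j : ℕ} (hj : 0 < j) (hjm : (fib j : ℤ) < m) :
      |(n : ℝ) * φ - a| ≤ |ψ| ^ j := by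
    rw [← abs_fib_mul_goldenRatio_sub_fib_succ]
    exact hbest _ ⟨fib j, by simp⟩ _ ⟨fib (j + 1), by simp⟩
      (mul_pos (by exact_mod_cast Nat.fib_pos.2 hj) hφ)
      (mul_lt_mul_of_pos_right (by exact_mod_cast hjm) hφ)
  obtain ⟨k, hk, hkm, hmk⟩ := exists_fib_succ_le_lt_fib_add_two (n := m) (by omega)
  obtain rfl : m = fib (k + 1) := by
    by_contra hne
    exact hne (eq_fib_succ_of_abs_mul_goldenRatio_sub_lt (hn.trans hnm) hmk
      ((hlt.trans_le (hbest_fib k.succ_pos (hkm.lt_of_ne' hne))).trans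
        (abs_goldenConj_pow_lt k.lt_succ_self))).1
  obtain ⟨k, rfl⟩ : ∃ j, k = j + 1 := Nat.exists_eq_add_one.2 (two_pos.trans_le hk)
  obtain ⟨rfl, rfl⟩ := eq_fib_succ_of_abs_mul_goldenRatio_sub_lt hn hnm
    ((hbest_fib k.succ_pos (by exact_mod_cast Nat.fib_lt_fib_succ hk)).trans_lt
      (abs_goldenConj_pow_lt k.lt_succ_self))
  obtain ⟨-, rfl⟩ := eq_fib_succ_of_abs_mul_goldenRatio_sub_lt (hn.trans hnm) hmk
    (hlt.trans_eq (abs_fib_mul_goldenRatio_sub_fib_succ (k + 1)))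
  exact ⟨k + 1, hk, rfl, rfl, rfl, rfl⟩

/-- The common form of the two ways to read off a Fibonacci digit: subtracting from `x` an element
of `A` in `[lo, hi)` leaves, modulo `B`, a residue strictly between `p` and `q`. -/
def HasDigit (A B : AddSubgroup ℝ) (lo hi p q x : ℝ) : Prop :=
  ∃ r ∈ A, ∃ t ∈ B, lo ≤ r ∧ r < hi ∧ x - r - t ∈ uIoo p q

theorem hasDigit_goldenRatio_mul_iff {n k : ℕ} :
    HasDigit (zmultiples φ) (zmultiples 1) (fib k * φ) (fib (k + 1) * φ) (ψ ^ (k + 1)) (ψ ^ (k + 2))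
      (n * φ) ↔ HasFibDigit n k := by
  simp only [HasDigit, AddSubgroup.exists_mem_zmultiples, zsmul_eq_mul, mul_one,
    mul_le_mul_iff_left₀ goldenRatio_pos, mul_lt_mul_iff_left₀ goldenRatio_pos, HasFibDigit,
    conjInterval, sub_mul]
  norm_cast

theorem hasDigit_natCast_iff {n k : ℕ} :
    HasDigit (zmultiples 1) (zmultiples φ) (fib k) (fib (k + 1)) (φ * ψ ^ (k + 1)) (φ * ψ ^ (k + 2))
      n ↔ HasFibDigit n k := by
  have hresidue (r s : ℤ) : (n : ℝ) - r - s * φ = φ * ((n - r) * φ - (n - r + s : ℤ)) := by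
    push_cast
    linear_combination -((n : ℝ) - r) * goldenRatio_sq
  simp only [HasDigit, AddSubgroup.exists_mem_zmultiples, zsmul_eq_mul, mul_one, hresidue,
    mul_mem_uIoo_mul_iff goldenRatio_ne_zero, HasFibDigit, conjInterval]
  norm_cast
  refine exists_congr fun r => (Equiv.addLeft (n - r : ℤ)).exists_congr fun s => ?_
  rfl

/-- The Fibonacci digits of `x` read off modulo `ℤ φ` agree with those of `y` read off modulo `ℤ`.
For `v = F_k φ`, `c = F_{k+1}`, `w = F_{k+1} φ` and `d = F_{k+2}`, the bounds below are
`d - c = F_k`, `c - v = ψ ^ k` and `d - w = ψ ^ (k + 1)`, whence `c - v + (d - w) = ψ ^ (k + 2)`,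
`v - c = φ ψ ^ (k + 1)` and `w - d = φ ψ ^ (k + 2)`. -/
def HaveSameDigits (x y : ℝ) : Prop :=
  ∀ v c w d, IsConsecutiveBestApprox (zmultiples φ) (zmultiples 1) v c w d →
    (HasDigit (zmultiples 1) (zmultiples φ) (d - c) c (v - c) (w - d) x ↔
      HasDigit (zmultiples φ) (zmultiples 1) v w (d - w) (c - v + (d - w)) y)

theorem haveSameDigits_iff_forall_hasFibDigit {m n : ℕ} :
    HaveSameDigits m (n * φ) ↔ ∀ k, 2 ≤ k → (HasFibDigit m k ↔ HasFibDigit n k) := by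
  have hfib (k : ℕ) : (fib (k + 2) : ℝ) - fib (k + 1) = fib k := by
    rw [Nat.fib_add_two]; push_cast; ring
  have hgap (k : ℕ) : (fib (k + 1) : ℝ) - fib k * φ = ψ ^ k := by
    rw [← neg_sub, fib_mul_goldenRatio_sub_fib_succ, neg_neg]
  have hgap' (k : ℕ) : (fib k : ℝ) * φ - fib (k + 1) = φ * ψ ^ (k + 1) := by
    rw [fib_mul_goldenRatio_sub_fib_succ]
    linear_combination -ψ ^ k * goldenRatio_mul_goldenConj
  have hadd (k : ℕ) : ψ ^ k + ψ ^ (k + 1) = ψ ^ (k + 2) := by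
    linear_combination -ψ ^ k * goldenConj_sq
  have hdigits (k : ℕ) :
      (HasDigit (zmultiples 1) (zmultiples φ) (fib (k + 2) - fib (k + 1)) (fib (k + 1))
          (fib k * φ - fib (k + 1)) (fib (k + 1) * φ - fib (k + 2)) m ↔
        HasDigit (zmultiples φ) (zmultiples 1) (fib k * φ) (fib (k + 1) * φ)
          (fib (k + 2) - fib (k + 1) * φ)
          (fib (k + 1) - fib k * φ + (fib (k + 2) - fib (k + 1) * φ)) (n * φ)) ↔
      (HasFibDigit m k ↔ HasFibDigit n k) := by
    rw [hfib, hgap k, hgap (k + 1), hgap' k, hgap' (k + 1), hadd, hasDigit_natCast_iff,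
      hasDigit_goldenRatio_mul_iff]
  refine ⟨fun h k hk => (hdigits k).1 (h _ _ _ _ (isConsecutiveBestApprox_fib hk)),
    fun h v c w d hvw => ?_⟩
  obtain ⟨k, hk, rfl, rfl, rfl, rfl⟩ := exists_fib_of_isConsecutiveBestApprox hvw
  exact (hdigits k).2 (h k hk)

theorem haveSameDigits_iff_eq {m n : ℕ} : HaveSameDigits m (n * φ) ↔ m = n :=
  haveSameDigits_iff_forall_hasFibDigit.trans
    ⟨eq_of_hasFibDigit_iff, by rintro rfl _ _; rfl⟩

theorem haveSameDigits_and_nonneg_iff {x y : ℝ} :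
    (x ∈ zmultiples (1 : ℝ) ∧ y ∈ zmultiples φ ∧ 0 ≤ x ∧ 0 ≤ y ∧ HaveSameDigits x y) ↔
      ∃ n : ℕ, x = n ∧ y = n * φ := by
  constructor
  · simp only [mem_zmultiples_iff_exists_mul, mul_one]
    rintro ⟨⟨m, rfl⟩, ⟨n, rfl⟩, hm, hn, h⟩
    lift m to ℕ using by exact_mod_cast hm
    lift n to ℕ using by exact_mod_cast nonneg_of_mul_nonneg_left hn goldenRatio_pos
    exact ⟨m, Int.cast_natCast m, by rw [haveSameDigits_iff_eq.1 h, Int.cast_natCast]⟩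
  · rintro ⟨n, rfl, rfl⟩
    exact ⟨mem_zmultiples_iff_exists_mul.2 ⟨n, by simp⟩,
      mem_zmultiples_iff_exists_mul.2 ⟨n, by simp⟩, n.cast_nonneg,
      mul_nonneg n.cast_nonneg goldenRatio_pos.le, haveSameDigits_iff_eq.2 rfl⟩

theorem eq_mul_iff_forall_mem_dense {K : Type*} [Field K] [LinearOrder K] [IsStrictOrderedRing K]
    [TopologicalSpace K] [OrderTopology K] {s : Set K} (hs : Dense s) {c x y : K} (hc : 0 < c) :
    y = c * x ↔ ∀ z ∈ s, (z < x ↔ c * z < y) := by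
  constructor
  · rintro rfl z -
    exact (mul_lt_mul_iff_right₀ hc).symm
  · intro h
    by_contra hne
    rcases lt_or_gt_of_ne hne with hlt | hlt
    · obtain ⟨z, hz, hyz, hzx⟩ := hs.exists_between ((div_lt_iff₀' hc).2 hlt)
      exact ((div_lt_iff₀' hc).1 hyz).not_gt ((h z hz).1 hzx)
    · obtain ⟨z, hz, hxz, hzy⟩ := hs.exists_between ((lt_div_iff₀' hc).2 hlt)
      exact hxz.not_gt ((h z hz).2 ((lt_div_iff₀' hc).1 hzy))

section DefinabilityCalculus

variable {L : Language} {M : Type*} {S : L.Structure M} {α : Type*}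

/-- A predicate on assignments `α → M` definable without parameters in an `L`-structure. The
structure is an explicit argument, so that the non-instances `RStructure a` can be used. Quantifiers
bind the variable `none` of `Option α`. -/
def DefinablePred (_S : L.Structure M) (P : (α → M) → Prop) : Prop :=
  (∅ : Set M).Definable L {v | P v}

/-- A function on assignments `α → M` definable without parameters in an `L`-structure. -/
def DefinableTerm (_S : L.Structure M) (t : (α → M) → M) : Prop :=
  (∅ : Set M).DefinableFun L t

namespace DefinablePred

variable {P Q : (α → M) → Prop}

protected theorem congr (hP : DefinablePred S P) (h : ∀ v, Q v ↔ P v) : DefinablePred S Q := by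
  rwa [funext fun v => propext (h v)]

protected theorem and (hP : DefinablePred S P) (hQ : DefinablePred S Q) :
    DefinablePred S fun v => P v ∧ Q v :=
  Set.Definable.inter hP hQ

protected theorem or (hP : DefinablePred S P) (hQ : DefinablePred S Q) :
    DefinablePred S fun v => P v ∨ Q v :=
  Set.Definable.union hP hQ

protected theorem not (hP : DefinablePred S P) : DefinablePred S fun v => ¬P v :=
  Set.Definable.compl hP

protected theorem imp (hP : DefinablePred S P) (hQ : DefinablePred S Q) :
    DefinablePred S fun v => P v → Q v :=
  Set.Definable.himp hP hQ

protected theorem iff (hP : DefinablePred S P) (hQ : DefinablePred S Q) :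
    DefinablePred S fun v => (P v ↔ Q v) :=
  ((hP.imp hQ).and (hQ.imp hP)).congr fun _ => iff_iff_implies_and_implies

theorem ex {P : (α → M) → M → Prop}
    (hP : DefinablePred S fun w : Option α → M => P (w ∘ some) (w none)) :
    DefinablePred S fun v => ∃ x, P v x :=
  DefinablePred.congr (Set.Definable.exists_of_finite
      (Set.Definable.preimage_comp (fun i : Option α => i.elim (Sum.inr ()) Sum.inl) hP))
    fun _ => ⟨fun ⟨x, hx⟩ => ⟨fun _ => x, hx⟩, fun ⟨_, hu⟩ => ⟨_, hu⟩⟩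

theorem all {P : (α → M) → M → Prop}
    (hP : DefinablePred S fun w : Option α → M => P (w ∘ some) (w none)) :
    DefinablePred S fun v => ∀ x, P v x :=
  (ex (P := fun v x => ¬P v x) hP.not).not.congr fun _ => not_exists_not.symm

theorem rel {n : ℕ} (R : L.Relations n) {t : Fin n → (α → M) → M}
    (ht : ∀ i, DefinableTerm S (t i)) :
    DefinablePred S fun v => Language.Structure.RelMap R fun i => t i v :=
  Set.Definable.preimage_map (F := fun v i => t i v) ht
    (Set.empty_definable_iff.2 ⟨R.formula Language.Term.var, rfl⟩)

end DefinablePred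

namespace DefinableTerm

variable {s t : (α → M) → M}

theorem var (i : α) : DefinableTerm S fun v : α → M => v i :=
  Language.definableFun_var L i

theorem lift (ht : DefinableTerm S t) :
    DefinableTerm S fun v : Option α → M => t (v ∘ some) :=
  Set.Definable.preimage_comp (Option.map some) ht

theorem func {n : ℕ} (f : L.Functions n) {t : Fin n → (α → M) → M}
    (ht : ∀ i, DefinableTerm S (t i)) :
    DefinableTerm S fun v => Language.Structure.funMap f fun i => t i v :=
  Set.DefinableFun.comp (g := fun v i => t i v) ht (Set.DefinableFun.fun_symbol f)

protected theorem eq (hs : DefinableTerm S s) (ht : DefinableTerm S t) :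
    DefinablePred S fun v => s v = t v :=
  Set.DefinableFun.ofPred_eq hs ht

protected theorem mem {A : Set M} (hs : DefinableTerm S s)
    (hA : DefinablePred S fun w : Unit → M => w () ∈ A) :
    DefinablePred S fun v => s v ∈ A :=
  Set.Definable.preimage_map (F := fun v _ => s v) (fun _ => hs) hA

theorem of_graph (h : DefinablePred S fun w : Option α → M => t (w ∘ some) = w none) :
    DefinableTerm S t :=
  h

end DefinableTerm

end DefinabilityCalculus

namespace DefinableTerm

variable {a : ℝ} {α : Type*} {s t p q : (α → ℝ) → ℝ}

protected theorem add (hs : DefinableTerm (RStructure a) s) (ht : DefinableTerm (RStructure a) t) :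
    DefinableTerm (RStructure a) fun v => s v + t v :=
  func (t := ![s, t]) (RFunctions.add : RLang.Functions 2) (Fin.forall_fin_two.2 ⟨hs, ht⟩)

protected theorem lt (hs : DefinableTerm (RStructure a) s) (ht : DefinableTerm (RStructure a) t) :
    DefinablePred (RStructure a) fun v => s v < t v :=
  .rel (t := ![s, t]) (RRelations.lt : RLang.Relations 2) (Fin.forall_fin_two.2 ⟨hs, ht⟩)

protected theorem le (hs : DefinableTerm (RStructure a) s) (ht : DefinableTerm (RStructure a) t) :
    DefinablePred (RStructure a) fun v => s v ≤ t v :=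
  (ht.lt hs).not.congr fun _ => not_lt.symm

theorem mem_zmultiples_one (hs : DefinableTerm (RStructure a) s) :
    DefinablePred (RStructure a) fun v => s v ∈ zmultiples (1 : ℝ) :=
  (DefinablePred.rel (t := ![s]) (RRelations.isInt : RLang.Relations 1)
    (Fin.forall_fin_one.2 hs)).congr fun _ => by
      simp [AddSubgroup.mem_zmultiples_iff, Language.Structure.RelMap, eq_comm]

theorem mem_zmultiples (hs : DefinableTerm (RStructure a) s) :
    DefinablePred (RStructure a) fun v => s v ∈ zmultiples a :=
  (DefinablePred.rel (t := ![s]) (RRelations.isIntMul : RLang.Relations 1)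
    (Fin.forall_fin_one.2 hs)).congr fun _ => by
      simp [AddSubgroup.mem_zmultiples_iff, Language.Structure.RelMap, eq_comm]

protected theorem sub (hs : DefinableTerm (RStructure a) s) (ht : DefinableTerm (RStructure a) t) :
    DefinableTerm (RStructure a) fun v => s v - t v :=
  of_graph ((hs.lift.eq ((var none).add ht.lift)).congr fun _ => sub_eq_iff_eq_add)

theorem zero : DefinableTerm (RStructure a) fun _ : α → ℝ => 0 :=
  of_graph (((var none).eq ((var none).add (var none))).congr fun _ => by simp [eq_comm])

protected theorem neg (hs : DefinableTerm (RStructure a) s) :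
    DefinableTerm (RStructure a) fun v => -s v := by
  simpa only [zero_sub] using zero.sub hs

protected theorem abs (hs : DefinableTerm (RStructure a) s) :
    DefinableTerm (RStructure a) fun v => |s v| :=
  have habs {b c : ℝ} : |b| = c ↔ 0 ≤ c ∧ (b = c ∨ b = -c) :=
    ⟨fun h => have hc := h ▸ abs_nonneg b; ⟨hc, (abs_eq hc).1 h⟩, fun h => (abs_eq h.1).2 h.2⟩
  have hnone := var (S := RStructure a) (none : Option α)
  of_graph <| ((zero.le hnone).and
    ((hs.lift.eq hnone).or (hs.lift.eq hnone.neg))).congr fun _ => habs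

theorem mem_uIoo (hp : DefinableTerm (RStructure a) p) (hq : DefinableTerm (RStructure a) q)
    (hs : DefinableTerm (RStructure a) s) :
    DefinablePred (RStructure a) fun v => s v ∈ uIoo (p v) (q v) :=
  (((hp.lt hs).and (hs.lt hq)).or ((hq.lt hs).and (hs.lt hp))).congr fun _ => by
    rw [uIoo_eq_union]; rfl

variable {A B : AddSubgroup ℝ}

theorem isConsecutiveBestApprox {v c w d : (α → ℝ) → ℝ}
    (hA : DefinablePred (RStructure a) fun u : Unit → ℝ => u () ∈ (A : Set ℝ))
    (hB : DefinablePred (RStructure a) fun u : Unit → ℝ => u () ∈ (B : Set ℝ))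
    (hv : DefinableTerm (RStructure a) v) (hc : DefinableTerm (RStructure a) c)
    (hw : DefinableTerm (RStructure a) w) (hd : DefinableTerm (RStructure a) d) :
    DefinablePred (RStructure a) fun x => IsConsecutiveBestApprox A B (v x) (c x) (w x) (d x) :=
  (hv.mem hA).and <| (hc.mem hB).and <| (hw.mem hA).and <| (hd.mem hB).and <| (zero.lt hv).and <|
    (hv.lt hw).and <| ((hw.sub hd).abs.lt (hv.sub hc).abs).and <|
    .all <| .imp ((var none).mem hA) <| .all <| .imp ((var none).mem hB) <|
    .imp (zero.lt (var (some none))) <| .imp ((var (some none)).lt hw.lift.lift) <|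
    (hv.sub hc).lift.lift.abs.le ((var (some none)).sub (var none)).abs

theorem hasDigit {lo hi p q x : (α → ℝ) → ℝ}
    (hA : DefinablePred (RStructure a) fun u : Unit → ℝ => u () ∈ (A : Set ℝ))
    (hB : DefinablePred (RStructure a) fun u : Unit → ℝ => u () ∈ (B : Set ℝ))
    (hlo : DefinableTerm (RStructure a) lo) (hhi : DefinableTerm (RStructure a) hi)
    (hp : DefinableTerm (RStructure a) p) (hq : DefinableTerm (RStructure a) q)
    (hx : DefinableTerm (RStructure a) x) :
    DefinablePred (RStructure a) fun v => HasDigit A B (lo v) (hi v) (p v) (q v) (x v) :=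
  .ex <| .and ((var none).mem hA) <| .ex <| .and ((var none).mem hB) <|
    .and (hlo.lift.lift.le (var (some none))) <| .and ((var (some none)).lt hhi.lift.lift) <|
    mem_uIoo hp.lift.lift hq.lift.lift ((hx.lift.lift.sub (var (some none))).sub (var none))

variable {x y : (α → ℝ) → ℝ}

theorem haveSameDigits (hx : DefinableTerm (RStructure φ) x) (hy : DefinableTerm (RStructure φ) y) :
    DefinablePred (RStructure φ) fun v => HaveSameDigits (x v) (y v) :=
  have hℤ : DefinablePred (RStructure φ) fun u : Unit → ℝ => u () ∈ (zmultiples (1 : ℝ) : Set ℝ) :=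
    mem_zmultiples_one (var _)
  have hℤφ : DefinablePred (RStructure φ) fun u : Unit → ℝ => u () ∈ (zmultiples φ : Set ℝ) :=
    mem_zmultiples (var _)
  have v := var (S := RStructure φ) (some (some (some (none : Option α))))
  have c := var (S := RStructure φ) (some (some (none : Option (Option α))))
  have w := var (S := RStructure φ) (some (none : Option (Option (Option α))))
  have d := var (S := RStructure φ) (none : Option (Option (Option (Option α))))
  .all <| .all <| .all <| .all <| (isConsecutiveBestApprox hℤφ hℤ v c w d).imp <|
    (hasDigit hℤ hℤφ (d.sub c) c (v.sub c) (w.sub d) hx.lift.lift.lift.lift).iff <|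
    hasDigit hℤφ hℤ v w (d.sub w) ((c.sub v).add (d.sub w)) hy.lift.lift.lift.lift

theorem exists_nat_eq_and_eq_mul (hx : DefinableTerm (RStructure φ) x)
    (hy : DefinableTerm (RStructure φ) y) :
    DefinablePred (RStructure φ) fun v => ∃ n : ℕ, x v = n ∧ y v = n * φ :=
  (hx.mem_zmultiples_one.and <| hy.mem_zmultiples.and <| (zero.le hx).and <| (zero.le hy).and <|
    hx.haveSameDigits hy).congr fun _ => haveSameDigits_and_nonneg_iff.symm

theorem exists_int_eq_and_eq_mul (hx : DefinableTerm (RStructure φ) x)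
    (hy : DefinableTerm (RStructure φ) y) :
    DefinablePred (RStructure φ) fun v => ∃ n : ℤ, x v = n ∧ y v = n * φ := by
  refine ((hx.exists_nat_eq_and_eq_mul hy).or (hx.neg.exists_nat_eq_and_eq_mul hy.neg)).congr
    fun v => ⟨?_, ?_⟩
  · rintro ⟨n, hn⟩
    obtain ⟨k, rfl | rfl⟩ := n.eq_nat_or_neg
    · exact .inl ⟨k, by simpa using hn⟩
    · exact .inr ⟨k, by simp [hn]⟩
  · rintro (⟨n, hn⟩ | ⟨n, hn⟩)
    · exact ⟨n, by simpa using hn⟩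
    · exact ⟨-n, by simpa [← neg_eq_iff_eq_neg] using hn⟩

end DefinableTerm

theorem eq_goldenRatio_mul_iff {x y : ℝ} :
    y = φ * x ↔ ∀ p q : ℝ, (∃ m : ℤ, p = m ∧ q = m * φ) →
      ∀ r s : ℝ, (∃ n : ℤ, r = n ∧ s = n * φ) → (p + s < x ↔ q + (r + s) < y) := by
  have hdense : Dense (AddSubgroup.closure {1, φ} : Set ℝ) :=
    dense_addSubgroupClosure_pair_iff.2 (one_div φ ▸ goldenRatio_irrational.inv)
  have hmul (m n : ℤ) : φ * (m + n * φ) = m * φ + (n + n * φ) := by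
    linear_combination n * goldenRatio_sq
  rw [eq_mul_iff_forall_mem_dense hdense goldenRatio_pos]
  constructor
  · rintro h _ _ ⟨m, rfl, rfl⟩ _ _ ⟨n, rfl, rfl⟩
    rw [← hmul]
    exact h _ (AddSubgroup.mem_closure_pair.2 ⟨m, n, by simp⟩)
  · intro h z hz
    obtain ⟨m, n, rfl⟩ := AddSubgroup.mem_closure_pair.1 hz
    simpa [← hmul] using h _ _ ⟨m, rfl, rfl⟩ _ _ ⟨n, rfl, rfl⟩

theorem DefinableTerm.eq_goldenRatio_mul {α : Type*} {x y : (α → ℝ) → ℝ}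
    (hx : DefinableTerm (RStructure φ) x) (hy : DefinableTerm (RStructure φ) y) :
    DefinablePred (RStructure φ) fun v => y v = φ * x v := by
  have p := var (S := RStructure φ) (some (some (some (none : Option α))))
  have q := var (S := RStructure φ) (some (some (none : Option (Option α))))
  have r := var (S := RStructure φ) (some (none : Option (Option (Option α))))
  have s := var (S := RStructure φ) (none : Option (Option (Option (Option α))))
  simp only [eq_goldenRatio_mul_iff]
  exact .all <| .all <| .imp (exists_int_eq_and_eq_mul (var (some none)) (var none)) <|
    .all <| .all <| .imp (r.exists_int_eq_and_eq_mul s) <|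
    .iff ((p.add s).lt hx.lift.lift.lift.lift) <|
    (q.add (r.add s)).lt hy.lift.lift.lift.lift

theorem theorem5p4 :
    DefinableInR ((1 + Real.sqrt 5) / 2) (fun x : ℝ => (1 + Real.sqrt 5) / 2 * x) :=
  DefinableTerm.eq_goldenRatio_mul (α := Fin 2) (.var 0) (.var 1)
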